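/- Consider online bipartite matching on a finite bipartite graph $G(S\cup R,E)$: the servers $S$ are known in advance, and the requests $R$ arrive one by one in a fixed order; when $r\in R$ arrives, its set of neighbours $N(r)\subseteq S$ is revealed and $r$ must irrevocably be matched to a currently unmatched neighbour or be left unmatched forever. The algorithm Ranking first draws for each server $s\in S$ an independent rank $y_s$, uniform on $[0,1]$, and then matches each arriving request to its unmatched neighbour of smallest rank, if it has an unmatched neighbour. The graph is called $(k,d)$-bounded if every server has degree at least $k$ and every request has degree at most $d$. Let $\Gamma(k,d)$, the competitive ratio of Ranking on $(k,d)$-bounded graphs, be the infimum of $\mathbb{E}[\mathsf{ALG}]/\mathsf{OPT}$ over all online instances (a $(k,d)$-bounded graph with an arrival order) with $\mathsf{OPT}>0$, where $\mathsf{ALG}$ is the size of the matching produced by Ranking and $\mathsf{OPT}$ is the size of a maximum matching of the graph. Theorem. For all integers $k>d\ge 2$, $$\Gamma(k,d)\;\le\;1-\Big(1-\frac1d\Big)^{k}\,\frac{d-1}{k+d-1}.$$ As a corollary, let $\alpha>1$ be real and let $(k_n),(d_n)$ be sequences of nonnegative integers with $d_n\to\infty$ and $k_n=\alpha d_n$ for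 all $n$. Then $$\limsup_{n\to\infty}\Gamma(k_n,d_n)\;\le\;1-\frac{e^{-\alpha}}{\alpha+1}.$$ -/

import Mathlib

namespace OnlineMatching

open MeasureTheory
open scoped ENNReal

/-- An instance of online bipartite matching: a finite bipartite graph whose servers are known
offline, and whose requests arrive online in the order `0, 1, …, numRequests - 1`.
`nbr r` is the set `N(r)` of servers adjacent to request `r`. -/
structure Instance where
  numServers : ℕ
  numRequests : ℕ
  nbr : Fin numRequests → Finset (Fin numServers)

namespace Instance

variable (I : Instance)

/-- The set `N(s)` of requests adjacent to the server `s`. -/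
def serverNbr (s : Fin I.numServers) : Finset (Fin I.numRequests) :=
  Finset.univ.filter fun r => s ∈ I.nbr r

/-- The graph is `(k, d)`-bounded: servers have degree at least `k`, requests at most `d`. -/
def IsBounded (k d : ℕ) : Prop :=
  (∀ s, k ≤ (I.serverNbr s).card) ∧ (∀ r, (I.nbr r).card ≤ d)

/-- A set of (server, request) pairs is a matching: all its members are edges,
and no two distinct members share a server or a request. -/
def IsMatching (M : Finset (Fin I.numServers × Fin I.numRequests)) : Prop :=
  (∀ e ∈ M, e.1 ∈ I.nbr e.2) ∧
    (∀ e ∈ M, ∀ f ∈ M, (e.1 = f.1 ∨ e.2 = f.2) → e = f)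

open Classical in
/-- The size of a maximum matching. -/
noncomputable def opt : ℕ :=
  (Finset.univ.filter fun M => I.IsMatching M).sup Finset.card

/-- The neighbours of `r` that are unmatched in `M`. -/
def available (M : Finset (Fin I.numServers × Fin I.numRequests)) (r : Fin I.numRequests) :
    Finset (Fin I.numServers) :=
  (I.nbr r).filter fun s => s ∉ M.image Prod.fst

/-- The available neighbours of `r` whose rank is smallest. -/
noncomputable def lowestRank (y : Fin I.numServers → unitInterval)
    (M : Finset (Fin I.numServers × Fin I.numRequests)) (r : Fin I.numRequests) :
    Finset (Fin I.numServers) :=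
  (I.available M r).filter fun s => ∀ t ∈ I.available M r, y s ≤ y t

/-- One round of Ranking: the arriving request `r` is matched to its available neighbour of
smallest rank, if it has an available neighbour, and stays unmatched otherwise. (Ties between
ranks, which have probability zero, are broken by index.) -/
noncomputable def rankingStep (y : Fin I.numServers → unitInterval)
    (M : Finset (Fin I.numServers × Fin I.numRequests)) (r : Fin I.numRequests) :
    Finset (Fin I.numServers × Fin I.numRequests) :=
  if h : (I.lowestRank y M r).Nonempty then insert ((I.lowestRank y M r).min' h, r) M else M

/-- The matching that Ranking produces on the ranks `y`, after all requests have arrived. -/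
noncomputable def ranking (y : Fin I.numServers → unitInterval) :
    Finset (Fin I.numServers × Fin I.numRequests) :=
  (List.finRange I.numRequests).foldl (I.rankingStep y) ∅

/-- The expected size of the matching produced by Ranking, the ranks of the servers being
independent and uniform on `[0, 1]`. -/
noncomputable def expRanking : ℝ≥0∞ :=
  ∫⁻ y : Fin I.numServers → unitInterval, ((I.ranking y).card : ℝ≥0∞)

end Instance

/-- The competitive ratio of Ranking on `(k, d)`-bounded graphs: the infimum of `E[ALG] / OPT`
over all online instances with a `(k, d)`-bounded graph (and `OPT > 0`, so that the ratio is
defined). The infimum is taken in `[0, ∞]`, where that of an empty family is `∞`. -/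
noncomputable def rankingRatio (k d : ℕ) : ℝ≥0∞ :=
  ⨅ (I : Instance) (_ : I.IsBounded k d) (_ : 0 < I.opt), I.expRanking / (I.opt : ℝ≥0∞)

end OnlineMatching

/-! Put `n = d - 1`. In the hard instance, `n` common servers compete with `k` private ones. Each of
the first `k` requests sees all common servers and its own private server. Later requests see one
private server each; they give the private servers degree `k` and let an optimal matching cover all
`n + k` servers, using early requests for the common ones. A common server still free after `k`
rounds stays free forever, so it suffices that the expected number of these is at least `n * (n / (n
+ 1)) ^ k`.

Suppose `D` common servers are free and the smallest of their ranks is `1 - x`. The private rank of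
the next request is fresh: with probability `1 - x` it is smaller and the state is unchanged.
Otherwise the lowest free common server is lost; the other `D - 1` ranks are independent and uniform
above `1 - x`, so the new value of `x` has mean `x * (D - 1) / D`. Since `survivalBound` is affine
in `x`, averaging it means evaluating it at this mean, and `survivalBound_succ_le` closes the
induction on rounds with a square as defect. Initially `D = n` and `x` has mean `n / (n + 1)`, so
the correction term vanishes.

Conditioning is replaced by indicators (`aboveRank`) and partial integrals (`lmarginal`), the bounds
being multiplied by the probability of the event. `SurvivalFrom` fixes the smallest rank,
`SurvivalAbove` averages over it; `SurvivalFrom.above` and `SurvivalFrom.cons` carry the induction.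
-/

namespace OnlineMatching

open MeasureTheory Finset
open scoped ENNReal

/-! ### Partial runs of Ranking: free servers, dependence on ranks, measurability -/

namespace Instance

variable {I : Instance}

/-- The partial run of Ranking on the list `L` of arriving requests, from the matching `M`. -/
noncomputable def run (I : Instance) (y : Fin I.numServers → unitInterval)
    (M : Finset (Fin I.numServers × Fin I.numRequests)) (L : List (Fin I.numRequests)) :
    Finset (Fin I.numServers × Fin I.numRequests) :=
  L.foldl (I.rankingStep y) M

/-- The servers of `A` that are unmatched in `M`. -/
def free (A : Finset (Fin I.numServers)) (M : Finset (Fin I.numServers × Fin I.numRequests)) :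
    Finset (Fin I.numServers) :=
  A.filter fun s => s ∉ M.image Prod.fst

theorem lowestRank_subset_available (y : Fin I.numServers → unitInterval)
    (M : Finset (Fin I.numServers × Fin I.numRequests)) (r : Fin I.numRequests) :
    I.lowestRank y M r ⊆ I.available M r :=
  Finset.filter_subset _ _

theorem rankingStep_of_forall_lt {y : Fin I.numServers → unitInterval}
    {M : Finset (Fin I.numServers × Fin I.numRequests)} {r : Fin I.numRequests}
    {s : Fin I.numServers} (hs : s ∈ I.available M r)
    (h : ∀ t ∈ I.available M r, t ≠ s → y s < y t) :
    I.rankingStep y M r = insert (s, r) M := by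
  have hl : I.lowestRank y M r = {s} := by
    ext t
    simp only [lowestRank, Finset.mem_filter, Finset.mem_singleton]
    constructor
    · rintro ⟨ht, hle⟩
      by_contra hts
      exact absurd (hle s hs) (not_le.2 (h t ht hts))
    · rintro rfl
      refine ⟨hs, fun u hu => ?_⟩
      by_cases hut : u = t
      · rw [hut]
      · exact (h u hu hut).le
  have hne : (I.lowestRank y M r).Nonempty := by rw [hl]; exact Finset.singleton_nonempty s
  have hmin : (I.lowestRank y M r).min' hne = s :=
    Finset.mem_singleton.1 (hl.le ((I.lowestRank y M r).min'_mem hne))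
  rw [rankingStep, dif_pos hne, hmin]

theorem rankingStep_eq_or (y : Fin I.numServers → unitInterval)
    (M : Finset (Fin I.numServers × Fin I.numRequests)) (r : Fin I.numRequests) :
    I.rankingStep y M r = M ∨
      ∃ s ∈ I.nbr r, s ∉ M.image Prod.fst ∧ I.rankingStep y M r = insert (s, r) M := by
  by_cases h : (I.lowestRank y M r).Nonempty
  · right
    have hm := lowestRank_subset_available y M r ((I.lowestRank y M r).min'_mem h)
    refine ⟨(I.lowestRank y M r).min' h, (Finset.mem_filter.1 hm).1, (Finset.mem_filter.1 hm).2, ?_⟩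
    rw [rankingStep, dif_pos h]
  · left
    rw [rankingStep, dif_neg h]

theorem card_image_fst_run (y : Fin I.numServers → unitInterval) (L : List (Fin I.numRequests))
    (M : Finset (Fin I.numServers × Fin I.numRequests)) (hM : (M.image Prod.fst).card = M.card) :
    ((I.run y M L).image Prod.fst).card = (I.run y M L).card := by
  induction L generalizing M with
  | nil => exact hM
  | cons r L ih =>
    apply ih
    rcases rankingStep_eq_or y M r with h | ⟨s, -, hs, h⟩
    · rw [h, hM]
    · rw [h, Finset.image_insert, Finset.card_insert_of_notMem hs, hM,
        Finset.card_insert_of_notMem fun hmem => hs (Finset.mem_image_of_mem Prod.fst hmem)]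

theorem free_insert (A : Finset (Fin I.numServers))
    (M : Finset (Fin I.numServers × Fin I.numRequests)) (s : Fin I.numServers)
    (r : Fin I.numRequests) : free A (insert (s, r) M) = (free A M).erase s := by
  ext t
  simp only [free, Finset.image_insert, Finset.mem_filter, Finset.mem_insert, Finset.mem_erase]
  tauto

theorem free_run_of_disjoint (A : Finset (Fin I.numServers)) (y : Fin I.numServers → unitInterval)
    (L : List (Fin I.numRequests)) (hL : ∀ r ∈ L, Disjoint (I.nbr r) A)
    (M : Finset (Fin I.numServers × Fin I.numRequests)) :
    free A (I.run y M L) = free A M := by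
  induction L generalizing M with
  | nil => rfl
  | cons r L ih =>
    have := ih (fun q hq => hL q (List.mem_cons_of_mem _ hq)) (I.rankingStep y M r)
    refine this.trans ?_
    rcases rankingStep_eq_or y M r with h | ⟨s, hs, -, h⟩
    · rw [h]
    · rw [h, free_insert, Finset.erase_eq_of_notMem]
      intro hmem
      exact Finset.disjoint_left.1 (hL r List.mem_cons_self) hs (Finset.mem_filter.1 hmem).1

theorem card_run_add_card_free_le (A : Finset (Fin I.numServers))
    (y : Fin I.numServers → unitInterval) (L : List (Fin I.numRequests)) :
    (I.run y ∅ L).card + (free A (I.run y ∅ L)).card ≤ I.numServers := by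
  rw [← card_image_fst_run y L ∅ rfl, ← Finset.card_union_of_disjoint]
  · exact (Finset.card_le_univ _).trans (by simp)
  · rw [Finset.disjoint_left]
    intro s hs hs'
    exact (Finset.mem_filter.1 hs').2 hs

theorem rankingStep_congr {y z : Fin I.numServers → unitInterval} {r : Fin I.numRequests}
    (h : ∀ s ∈ I.nbr r, ∀ t ∈ I.nbr r, (y s ≤ y t ↔ z s ≤ z t))
    (M : Finset (Fin I.numServers × Fin I.numRequests)) :
    I.rankingStep y M r = I.rankingStep z M r := by
  have hl : I.lowestRank y M r = I.lowestRank z M r := by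
    apply Finset.filter_congr
    intro s hs
    refine forall₂_congr fun t ht => ?_
    exact h s (Finset.mem_filter.1 hs).1 t (Finset.mem_filter.1 ht).1
  simp only [rankingStep, hl]

theorem run_congr {y z : Fin I.numServers → unitInterval} (L : List (Fin I.numRequests))
    (h : ∀ r ∈ L, ∀ s ∈ I.nbr r, ∀ t ∈ I.nbr r, (y s ≤ y t ↔ z s ≤ z t))
    (M : Finset (Fin I.numServers × Fin I.numRequests)) :
    I.run y M L = I.run z M L := by
  induction L generalizing M with
  | nil => rfl
  | cons r L ih =>
    change I.run y (I.rankingStep y M r) L = I.run z (I.rankingStep z M r) L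
    rw [rankingStep_congr (h r List.mem_cons_self) M]
    exact ih (fun q hq => h q (List.mem_cons_of_mem _ hq)) _

theorem run_update {L : List (Fin I.numRequests)} {i : Fin I.numServers}
    (h : ∀ r ∈ L, i ∉ I.nbr r) (y : Fin I.numServers → unitInterval) (t : unitInterval)
    (M : Finset (Fin I.numServers × Fin I.numRequests)) :
    I.run (Function.update y i t) M L = I.run y M L := by
  refine run_congr L (fun r hr u hu v hv => ?_) M
  have hu' : u ≠ i := fun e => h r hr (e ▸ hu)
  have hv' : v ≠ i := fun e => h r hr (e ▸ hv)
  simp [hu', hv']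

/-- A run sees the ranks only through their pairwise comparisons, so the function factors through a
measurable map into a finite discrete space. -/
theorem measurable_of_run (L : List (Fin I.numRequests))
    (M : Finset (Fin I.numServers × Fin I.numRequests))
    (g : Finset (Fin I.numServers × Fin I.numRequests) → ℝ≥0∞) :
    Measurable fun y => g (I.run y M L) := by
  let c : (Fin I.numServers → unitInterval) → Fin I.numServers → Fin I.numServers → Prop :=
    fun y s t => y s ≤ y t
  have hc : Measurable c := by
    refine measurable_pi_iff.2 fun s => measurable_pi_iff.2 fun t => ?_
    exact measurableSet_setOfPred.1 (measurableSet_le (measurable_pi_apply s) (measurable_pi_apply t))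
  have hf : Function.FactorsThrough (fun y => g (I.run y M L)) c := by
    intro y z hyz
    have : I.run y M L = I.run z M L :=
      run_congr L (fun r _ s _ t _ => iff_of_eq (congrFun (congrFun hyz s) t)) M
    simp only [this]
  have : (fun y => g (I.run y M L)) =
      Function.extend c (fun y => g (I.run y M L)) (fun _ => 0) ∘ c := by
    funext y
    exact (hf.extend_apply _ y).symm
  rw [this]
  exact (Measurable.of_discrete).comp hc

end Instance

/-! ### The survival bound: one-round inequality and average over the smallest rank -/

/-- A lower bound for the expected number of servers that stay unmatched during the next `j` rounds,
when `D` servers are unmatched and `x` is the probability that a fresh uniform rank exceeds the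
smallest of their ranks. -/
noncomputable def survivalBound (n : ℝ) (j : ℕ) (D x : ℝ) : ℝ :=
  (n / (n + 1)) ^ j * (D + j / n * (D - (n + 1) * x))

/-- The two sides differ by a nonnegative multiple of `(D - (n + 1) * x) ^ 2`, so the bound is
lossless on the line `D = (n + 1) * x`, where the process starts on average. -/
theorem survivalBound_succ_le {n : ℝ} (hn : 0 < n) (j : ℕ) {D : ℝ} (hD : 0 < D) (x : ℝ) :
    survivalBound n (j + 1) D x ≤
      (1 - x) * survivalBound n j D x + x * survivalBound n j (D - 1) (x * (D - 1) / D) := by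
  have key : (1 - x) * survivalBound n j D x + x * survivalBound n j (D - 1) (x * (D - 1) / D) -
      survivalBound n (j + 1) D x =
      (n / (n + 1)) ^ j * (j / n * ((D - (n + 1) * x) ^ 2 / (D * (n + 1)))) := by
    unfold survivalBound
    rw [pow_succ]
    push_cast
    field_simp
    ring
  have : 0 ≤ (n / (n + 1)) ^ j * (j / n * ((D - (n + 1) * x) ^ 2 / (D * (n + 1)))) := by
    positivity
  linarith

/-- Needed because `survivalBound` can be negative: truncating at zero before integrating only
increases the value. -/
theorem ofReal_integral_le_lintegral_ofReal {α : Type*} [MeasurableSpace α] {μ : Measure α}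
    {f : α → ℝ} (hf : Integrable f μ) :
    ENNReal.ofReal (∫ a, f a ∂μ) ≤ ∫⁻ a, ENNReal.ofReal (f a) ∂μ := by
  have h1 : ∫ a, f a ∂μ ≤ ∫ a, max (f a) 0 ∂μ :=
    integral_mono hf hf.pos_part fun a => le_max_left _ _
  refine (ENNReal.ofReal_le_ofReal h1).trans ?_
  rw [ofReal_integral_eq_lintegral_ofReal hf.pos_part
    (Filter.Eventually.of_forall fun a => le_max_right _ _)]
  exact lintegral_mono fun a => by simp [ENNReal.ofReal_max]

/-- Up to a constant, `(1 - a) ^ D` is the density of the smallest of `D + 1` uniform ranks above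
`c`. An affine function of `1 - a` averages to its value at the mean `(1 - c) * (D + 1) / (D + 2)`.
-/
theorem survivalBound_integral (n : ℝ) (j D : ℕ) (c : ℝ) :
    ∫ a in c..1, survivalBound n j (D + 1 : ℕ) (1 - a) * (1 - a) ^ D =
      survivalBound n j (D + 1 : ℕ) ((1 - c) * (D + 1 : ℕ) / ((D + 1 : ℕ) + 1)) *
        (1 - c) ^ (D + 1) / (D + 1 : ℕ) := by
  set q : ℝ := (n / (n + 1)) ^ j with hq
  have hderiv : ∀ a ∈ Set.uIcc c 1, HasDerivAt (fun a : ℝ =>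
      -(q * ((((D + 1 : ℕ) : ℝ) + j / n * (D + 1 : ℕ)) * ((1 - a) ^ (D + 1) / (D + 1 : ℕ))
        - j / n * (n + 1) * ((1 - a) ^ (D + 2) / (D + 2 : ℕ)))))
      (survivalBound n j (D + 1 : ℕ) (1 - a) * (1 - a) ^ D) a := by
    intro a _
    have h0 : HasDerivAt (fun a : ℝ => 1 - a) (-1) a := by
      simpa using (hasDerivAt_id a).const_sub 1
    have h1 := (h0.pow (D + 1)).div_const (((D + 1 : ℕ) : ℝ))
    have h2 := (h0.pow (D + 2)).div_const (((D + 2 : ℕ) : ℝ))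
    refine ((((h1.const_mul (((D + 1 : ℕ) : ℝ) + j / n * (D + 1 : ℕ))).sub
      (h2.const_mul (j / n * (n + 1)))).const_mul q).neg).congr_deriv ?_
    unfold survivalBound
    rw [← hq]
    have e1 : ((D + 1 : ℕ) : ℝ) ≠ 0 := by positivity
    have e2 : ((D + 2 : ℕ) : ℝ) ≠ 0 := by positivity
    have e3 : ∀ m : ℕ, m + 1 - 1 = m := fun m => rfl
    have e4 : ∀ m : ℕ, m + 2 - 1 = m + 1 := fun m => rfl
    rw [e3, e4, mul_assoc ((D + 1 : ℕ) : ℝ), mul_div_cancel_left₀ _ e1,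
      mul_assoc ((D + 2 : ℕ) : ℝ), mul_div_cancel_left₀ _ e2]
    ring
  rw [intervalIntegral.integral_eq_sub_of_hasDerivAt hderiv]
  · unfold survivalBound
    rw [← hq]
    simp only [sub_self, ne_eq, Nat.add_eq_zero_iff, one_ne_zero, OfNat.ofNat_ne_zero, and_false,
      not_false_eq_true, zero_pow, zero_div, mul_zero, neg_zero, sub_neg_eq_add, zero_add]
    push_cast
    have e1 : (D : ℝ) + 1 ≠ 0 := by positivity
    have e2 : (D : ℝ) + 2 ≠ 0 := by positivity
    have e3 : (D : ℝ) + 1 + 1 = D + 2 := by ring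
    rw [e3]
    generalize (j : ℝ) / n = w
    field_simp
    ring
  · apply Continuous.intervalIntegrable
    unfold survivalBound
    fun_prop

theorem le_lintegral_Ioi_survivalBound (n : ℝ) (j D : ℕ) (c : unitInterval) :
    ENNReal.ofReal (survivalBound n j (D + 1 : ℕ)
        ((1 - c) * (D + 1 : ℕ) / ((D + 1 : ℕ) + 1)) * (1 - c) ^ (D + 1) / (D + 1 : ℕ)) ≤
      ∫⁻ a : unitInterval in Set.Ioi c,
        ENNReal.ofReal (survivalBound n j (D + 1 : ℕ) (1 - a) * (1 - a) ^ D) := by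
  have hcont : Continuous fun a : ℝ => survivalBound n j (D + 1 : ℕ) (1 - a) * (1 - a) ^ D := by
    unfold survivalBound
    fun_prop
  have hint : Integrable (fun a : unitInterval =>
      survivalBound n j (D + 1 : ℕ) (1 - a) * (1 - a) ^ D) (volume.restrict (Set.Ioi c)) :=
    ((hcont.comp continuous_subtype_val).integrable_of_hasCompactSupport
      (HasCompactSupport.of_compactSpace _)).integrableOn
  refine le_trans (le_of_eq ?_) (ofReal_integral_le_lintegral_ofReal hint)
  congr 1
  rw [← survivalBound_integral, intervalIntegral.integral_of_le c.2.2]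
  have hpre : (Set.Ioi c : Set unitInterval) = ((↑) : unitInterval → ℝ) ⁻¹' Set.Ioc (c : ℝ) 1 := by
    ext a
    simp [a.2.2]
  rw [hpre, unitInterval.measurePreserving_coe.setIntegral_preimage_emb
    unitInterval.measurableEmbedding_coe
    (fun a : ℝ => survivalBound n j (D + 1 : ℕ) (1 - a) * (1 - a) ^ D),
    Measure.restrict_restrict measurableSet_Ioc]
  congr 2
  ext a
  simp only [Set.mem_Ioc, Set.mem_inter_iff, Set.mem_Icc]
  constructor
  · intro h
    exact ⟨h, c.2.1.trans h.1.le, h.2⟩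
  · exact fun h => h.1

/-! ### Partial integration over ranks -/

section Marginal

variable {ι : Type*}

/-- The indicator function of the event that all ranks in `T` exceed `c`. -/
noncomputable def aboveRank (T : Finset ι) (c : unitInterval) (y : ι → unitInterval) : ℝ≥0∞ :=
  if ∀ t ∈ T, c < y t then 1 else 0

theorem aboveRank_le_one (T : Finset ι) (c : unitInterval) (y : ι → unitInterval) :
    aboveRank T c y ≤ 1 := by
  unfold aboveRank
  split_ifs <;> simp

theorem measurable_aboveRank (T : Finset ι) {c : (ι → unitInterval) → unitInterval}
    (hc : Measurable c) : Measurable fun y : ι → unitInterval => aboveRank T (c y) y := by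
  unfold aboveRank
  refine Measurable.ite ?_ measurable_const measurable_const
  have : {y : ι → unitInterval | ∀ t ∈ T, c y < y t} =
      ⋂ t ∈ T, {y : ι → unitInterval | c y < y t} := by
    ext y
    simp
  rw [this]
  exact T.measurableSet_biInter fun t _ => measurableSet_lt hc (measurable_pi_apply t)

variable [DecidableEq ι] {T : Finset ι} {x : ι → unitInterval}

theorem lmarginal_le_lmarginal {f g : (ι → unitInterval) → ℝ≥0∞}
    (h : ∀ z, (∀ i ∉ T, z i = x i) → f z ≤ g z) :
    lmarginal (fun _ => volume) T f x ≤ lmarginal (fun _ => volume) T g x := by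
  refine lintegral_mono fun z => h _ fun i hi => ?_
  simp [Function.updateFinset_def, hi]

theorem sum_lmarginal_le {κ : Type*} (K : Finset κ) (f : κ → (ι → unitInterval) → ℝ≥0∞) :
    ∑ i ∈ K, lmarginal (fun _ => volume) T (f i) x ≤
      lmarginal (fun _ => volume) T (fun z => ∑ i ∈ K, f i z) x := by
  classical
  induction K using Finset.induction with
  | empty => simp
  | insert a K ha ih =>
    simp only [Finset.sum_insert ha]
    exact (add_le_add le_rfl ih).trans (le_lintegral_add _ _)

theorem mul_lmarginal_le (r : ℝ≥0∞) (f : (ι → unitInterval) → ℝ≥0∞) :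
    r * lmarginal (fun _ => volume) T f x ≤ lmarginal (fun _ => volume) T (fun z => r * f z) x :=
  lintegral_const_mul_le _ _

theorem lmarginal_add_lmarginal_le (f g : (ι → unitInterval) → ℝ≥0∞) :
    lmarginal (fun _ => volume) T f x + lmarginal (fun _ => volume) T g x ≤
      lmarginal (fun _ => volume) T (fun z => f z + g z) x :=
  le_lintegral_add _ _

theorem lmarginal_aboveRank (T : Finset ι) (c : unitInterval) (x : ι → unitInterval) :
    lmarginal (fun _ => volume) T (aboveRank T c) x = ENNReal.ofReal (1 - c) ^ T.card := by
  classical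
  have h : ∀ w : T → unitInterval, aboveRank T c (Function.updateFinset x T w) =
      (Set.univ.pi fun _ : T => Set.Ioi c).indicator 1 w := by
    intro w
    rw [aboveRank, Set.indicator_apply]
    refine if_congr ?_ rfl rfl
    simp only [Set.mem_pi, Set.mem_univ, Set.mem_Ioi, true_implies, Subtype.forall]
    refine forall₂_congr fun t ht => ?_
    simp [Function.updateFinset_def, ht]
  simp only [lmarginal, h]
  rw [lintegral_indicator_one (MeasurableSet.univ_pi fun _ => measurableSet_Ioi), Measure.pi_pi]
  simp

/-- At most one element of `T` has the strictly smallest rank; ties make the left side zero, so no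
null set has to be discarded. -/
theorem sum_aboveRank_erase_le (T : Finset ι) (c : unitInterval) (y : ι → unitInterval) :
    ∑ s ∈ T, aboveRank {s} c y * aboveRank (T.erase s) (y s) y ≤ aboveRank T c y := by
  by_cases h : ∃ s ∈ T, c < y s ∧ ∀ t ∈ T.erase s, y s < y t
  · obtain ⟨s, hs, hc, hlt⟩ := h
    rw [Finset.sum_eq_single_of_mem s hs]
    · have : ∀ t ∈ T, c < y t := fun t ht => by
        by_cases hts : t = s
        · rwa [hts]
        · exact hc.trans (hlt t (Finset.mem_erase.2 ⟨hts, ht⟩))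
      rw [aboveRank, aboveRank, aboveRank, if_pos this]
      split_ifs <;> simp
    · intro t ht hts
      have : ¬ ∀ u ∈ T.erase t, y t < y u := fun hall =>
        lt_asymm (hall s (Finset.mem_erase.2 ⟨hts.symm, hs⟩)) (hlt t (Finset.mem_erase.2 ⟨hts, ht⟩))
      rw [aboveRank, aboveRank, if_neg this, mul_zero]
  · push Not at h
    rw [Finset.sum_eq_zero]
    · exact zero_le
    · intro s hs
      by_cases hc : c < y s
      · obtain ⟨t, ht, hle⟩ := h s hs hc
        have : ¬ ∀ u ∈ T.erase s, y s < y u := fun hall => absurd (hall t ht) (not_lt.2 hle)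
        rw [aboveRank, aboveRank, if_neg this, mul_zero]
      · have : ¬ ∀ u ∈ ({s} : Finset ι), c < y u := fun hall => hc (hall s (by simp))
        rw [aboveRank, if_neg this, zero_mul]

end Marginal

/-! ### Induction over the requests that see the common servers -/

namespace Instance

variable {I : Instance}

/-- The requests in `L` share the neighbours `A`, and each has one further neighbour `b r`
of its own. -/
structure IsStarList (I : Instance) (A : Finset (Fin I.numServers))
    (b : Fin I.numRequests → Fin I.numServers) (L : List (Fin I.numRequests)) : Prop where
  nbr_eq : ∀ r ∈ L, I.nbr r = insert (b r) A
  notMem : ∀ r ∈ L, b r ∉ A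
  nodup : (L.map b).Nodup

variable {A : Finset (Fin I.numServers)} {b : Fin I.numRequests → Fin I.numServers}
  {L : List (Fin I.numRequests)} {r : Fin I.numRequests}

theorem IsStarList.tail (h : I.IsStarList A b (r :: L)) : I.IsStarList A b L :=
  ⟨fun q hq => h.nbr_eq q (List.mem_cons_of_mem _ hq),
    fun q hq => h.notMem q (List.mem_cons_of_mem _ hq), (List.nodup_cons.1 h.nodup).2⟩

theorem IsStarList.head_notMem (h : I.IsStarList A b (r :: L)) :
    ∀ q ∈ L, b r ∉ I.nbr q := by
  intro q hq hmem
  rw [h.nbr_eq q (List.mem_cons_of_mem _ hq), Finset.mem_insert] at hmem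
  rcases hmem with hmem | hmem
  · exact (List.nodup_cons.1 h.nodup).1 (List.mem_map.2 ⟨q, hq, hmem.symm⟩)
  · exact h.notMem r List.mem_cons_self hmem

theorem IsStarList.available_eq (h : I.IsStarList A b (r :: L))
    {M : Finset (Fin I.numServers × Fin I.numRequests)} (hM : b r ∉ M.image Prod.fst) :
    I.available M r = insert (b r) (free A M) := by
  rw [available, h.nbr_eq r List.mem_cons_self, Finset.filter_insert, if_pos hM, free]

/-- The lower bound for the expected number of servers of `A` that stay unmatched, when the ranks of
the unmatched servers of `A` exceed that of `s`, one of them. -/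
def SurvivalFrom (I : Instance) (n : ℝ) (A : Finset (Fin I.numServers))
    (b : Fin I.numRequests → Fin I.numServers) (L : List (Fin I.numRequests)) : Prop :=
  ∀ M : Finset (Fin I.numServers × Fin I.numRequests), (∀ r ∈ L, b r ∉ M.image Prod.fst) →
    ∀ s ∈ free A M, ∀ y : Fin I.numServers → unitInterval,
      ENNReal.ofReal (survivalBound n L.length (free A M).card (1 - y s) *
          (1 - y s) ^ ((free A M).card - 1)) ≤
        lmarginal (fun _ => volume) ((free A M).erase s ∪ (L.map b).toFinset)
          (fun z => aboveRank ((free A M).erase s) (z s) z * ((free A (I.run z M L)).card : ℝ≥0∞)) y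

/-- The lower bound for the expected number of servers of `A` that stay unmatched, when the ranks of
the unmatched servers of `A` exceed `c`. -/
def SurvivalAbove (I : Instance) (n : ℝ) (A : Finset (Fin I.numServers))
    (b : Fin I.numRequests → Fin I.numServers) (L : List (Fin I.numRequests)) : Prop :=
  ∀ M : Finset (Fin I.numServers × Fin I.numRequests), (∀ r ∈ L, b r ∉ M.image Prod.fst) →
    ∀ (c : unitInterval) (y : Fin I.numServers → unitInterval),
      ENNReal.ofReal (survivalBound n L.length (free A M).card
          ((1 - c) * (free A M).card / ((free A M).card + 1)) * (1 - c) ^ (free A M).card) ≤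
        lmarginal (fun _ => volume) (free A M ∪ (L.map b).toFinset)
          (fun z => aboveRank (free A M) c z * ((free A (I.run z M L)).card : ℝ≥0∞)) y

/-- Split according to which free server `s` has the smallest rank `a > c`, and integrate over `a`.
Each of the `D + 1` choices of `s` contributes the same share of the bound. -/
theorem SurvivalFrom.above {n : ℝ} (hL : I.IsStarList A b L) (h : I.SurvivalFrom n A b L) :
    I.SurvivalAbove n A b L := by
  intro M hM c y
  set S := free A M with hS
  set B := (L.map b).toFinset with hB
  have hSA : S ⊆ A := Finset.filter_subset _ _
  have hBA : ∀ t ∈ B, t ∉ A := by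
    intro t ht
    obtain ⟨r, hr, rfl⟩ := List.mem_map.1 (List.mem_toFinset.1 ht)
    exact hL.notMem r hr
  rcases Nat.eq_zero_or_pos S.card with h0 | hpos
  · simp [h0, survivalBound]
  obtain ⟨D, hD⟩ : ∃ D, S.card = D + 1 := ⟨S.card - 1, by omega⟩
  let G : (Fin I.numServers → unitInterval) → ℝ≥0∞ := fun z => ((free A (I.run z M L)).card : ℝ≥0∞)
  have hG : Measurable G := measurable_of_run L M fun N => ((free A N).card : ℝ≥0∞)
  let F : Fin I.numServers → (Fin I.numServers → unitInterval) → ℝ≥0∞ := fun s z =>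
    aboveRank {s} c z * (aboveRank (S.erase s) (z s) z * G z)
  have hF : ∀ s, Measurable (F s) := fun s => (measurable_aboveRank _ measurable_const).mul
    ((measurable_aboveRank _ (measurable_pi_apply s)).mul hG)
  set v : ℝ := survivalBound n L.length (D + 1 : ℕ)
        ((1 - c) * (D + 1 : ℕ) / ((D + 1 : ℕ) + 1)) * (1 - c) ^ (D + 1) with hv
  have hterm : ∀ s ∈ S, ENNReal.ofReal (v / (D + 1 : ℕ)) ≤
      lmarginal (fun _ => volume) (S ∪ B) (F s) y := by
    intro s hs
    have hsT : s ∉ S.erase s ∪ B := by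
      simp only [Finset.mem_union, Finset.mem_erase, ne_eq, not_true_eq_false, false_and, false_or]
      exact fun hsB => hBA s hsB (hSA hs)
    have hT : S ∪ B = insert s (S.erase s ∪ B) := by
      rw [← Finset.insert_union, Finset.insert_erase hs]
    rw [hT, lmarginal_insert _ (hF s) hsT]
    refine (le_lintegral_Ioi_survivalBound n L.length D c).trans ?_
    rw [← lintegral_indicator measurableSet_Ioi]
    refine lintegral_mono fun a => ?_
    by_cases hca : c < a
    · rw [Set.indicator_of_mem (Set.mem_Ioi.2 hca)]
      have := h M hM s hs (Function.update y s a)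
      rw [← hS, hD, Function.update_self] at this
      refine this.trans (lmarginal_le_lmarginal fun z hz => ?_)
      have hzs : z s = a := by rw [hz s hsT, Function.update_self]
      have : aboveRank {s} c z = 1 := if_pos (by simpa [hzs] using hca)
      change _ ≤ F s z
      simp only [F, G, this, one_mul, le_refl]
    · rw [Set.indicator_of_notMem (by simpa using hca)]
      exact zero_le
  rw [hD, ← hv]
  calc ENNReal.ofReal v = ∑ _s ∈ S, ENNReal.ofReal (v / (D + 1 : ℕ)) := by
        rw [Finset.sum_const, hD, ← ENNReal.ofReal_nsmul, nsmul_eq_mul, mul_div_cancel₀]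
        positivity
    _ ≤ ∑ s ∈ S, lmarginal (fun _ => volume) (S ∪ B) (F s) y := Finset.sum_le_sum hterm
    _ ≤ lmarginal (fun _ => volume) (S ∪ B) (fun z => ∑ s ∈ S, F s z) y := sum_lmarginal_le _ _
    _ ≤ _ := lmarginal_le_lmarginal fun z _ => by
        simp only [F, ← mul_assoc, ← Finset.sum_mul]
        gcongr
        exact sum_aboveRank_erase_le S c z

theorem IsStarList.run_cons_of_lt (h : I.IsStarList A b (r :: L))
    {M : Finset (Fin I.numServers × Fin I.numRequests)} (hM : b r ∉ M.image Prod.fst)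
    {s : Fin I.numServers} {z : Fin I.numServers → unitInterval}
    (hz : ∀ t ∈ (free A M).erase s, z s < z t) {t : unitInterval} (ht : t < z s) :
    I.run (Function.update z (b r) t) M (r :: L) = I.run z (insert (b r, r) M) L := by
  have hne : ∀ u ∈ free A M, u ≠ b r := fun u hu e =>
    h.notMem r List.mem_cons_self (e ▸ (Finset.mem_filter.1 hu).1)
  -- No later request sees `b r`, so its rank may be changed on the right-hand side as well.
  rw [← run_update h.head_notMem z t]
  change I.run _ (I.rankingStep _ M r) L = _
  rw [rankingStep_of_forall_lt (s := b r)]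
  · rw [h.available_eq hM]
    exact Finset.mem_insert_self _ _
  · intro u hu hub
    rw [h.available_eq hM, Finset.mem_insert, or_iff_right hub] at hu
    rw [Function.update_self, Function.update_of_ne hub]
    by_cases hus : u = s
    · rwa [hus]
    · exact ht.trans (hz u (Finset.mem_erase.2 ⟨hus, hu⟩))

theorem IsStarList.run_cons_of_gt (h : I.IsStarList A b (r :: L))
    {M : Finset (Fin I.numServers × Fin I.numRequests)} (hM : b r ∉ M.image Prod.fst)
    {s : Fin I.numServers} (hs : s ∈ free A M) {z : Fin I.numServers → unitInterval}
    (hz : ∀ t ∈ (free A M).erase s, z s < z t) {t : unitInterval} (ht : z s < t) :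
    I.run (Function.update z (b r) t) M (r :: L) = I.run z (insert (s, r) M) L := by
  have hsb : s ≠ b r := fun e => h.notMem r List.mem_cons_self (e ▸ (Finset.mem_filter.1 hs).1)
  rw [← run_update h.head_notMem z t]
  change I.run _ (I.rankingStep _ M r) L = _
  rw [rankingStep_of_forall_lt (s := s)]
  · rw [h.available_eq hM]
    exact Finset.mem_insert_of_mem hs
  · intro u hu hus
    rw [Function.update_of_ne hsb]
    by_cases hub : u = b r
    · rwa [hub, Function.update_self]
    · rw [h.available_eq hM, Finset.mem_insert, or_iff_right hub] at hu
      rw [Function.update_of_ne hub]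
      exact hz u (Finset.mem_erase.2 ⟨hus, hu⟩)

/-- Integrates over the rank `t` of the private server `b r`: it wins for `t < z s`, and `s` wins
for `t > z s`. The tie is dropped, which is harmless for a lower bound. -/
theorem IsStarList.head_step (h : I.IsStarList A b (r :: L))
    {M : Finset (Fin I.numServers × Fin I.numRequests)} (hM : b r ∉ M.image Prod.fst)
    {s : Fin I.numServers} (hs : s ∈ free A M) (z : Fin I.numServers → unitInterval) :
    ENNReal.ofReal (z s) * (aboveRank ((free A M).erase s) (z s) z *
        ((free A (I.run z (insert (b r, r) M) L)).card : ℝ≥0∞)) +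
      ENNReal.ofReal (1 - z s) * (aboveRank ((free A M).erase s) (z s) z *
        ((free A (I.run z (insert (s, r) M) L)).card : ℝ≥0∞)) ≤
    ∫⁻ t, aboveRank ((free A M).erase s) (Function.update z (b r) t s)
        (Function.update z (b r) t) *
      ((free A (I.run (Function.update z (b r) t) M (r :: L))).card : ℝ≥0∞) := by
  by_cases hz : ∀ t ∈ (free A M).erase s, z s < z t
  swap
  · rw [aboveRank, if_neg hz]
    simp
  have hne : ∀ u ∈ free A M, u ≠ b r := fun u hu e =>
    h.notMem r List.mem_cons_self (e ▸ (Finset.mem_filter.1 hu).1)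
  have hab : aboveRank ((free A M).erase s) (z s) z = 1 := if_pos hz
  have hab' : ∀ t, aboveRank ((free A M).erase s) (Function.update z (b r) t s)
        (Function.update z (b r) t) = 1 := by
    intro t
    refine if_pos fun u hu => ?_
    rw [Function.update_of_ne (hne s hs),
      Function.update_of_ne (hne u (Finset.mem_of_mem_erase hu))]
    exact hz u hu
  simp only [hab, hab', one_mul]
  set g₁ : ℝ≥0∞ := ((free A (I.run z (insert (b r, r) M) L)).card : ℝ≥0∞)
  set g₂ : ℝ≥0∞ := ((free A (I.run z (insert (s, r) M) L)).card : ℝ≥0∞)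
  calc ENNReal.ofReal (z s) * g₁ + ENNReal.ofReal (1 - z s) * g₂
      = (∫⁻ t : unitInterval, (Set.Iio (z s)).indicator (fun _ => g₁) t) +
          ∫⁻ t : unitInterval, (Set.Ioi (z s)).indicator (fun _ => g₂) t := by
        rw [lintegral_indicator_const measurableSet_Iio, lintegral_indicator_const measurableSet_Ioi,
          unitInterval.volume_Iio, unitInterval.volume_Ioi, mul_comm, mul_comm g₂]
    _ ≤ ∫⁻ t : unitInterval, ((Set.Iio (z s)).indicator (fun _ => g₁) t +
          (Set.Ioi (z s)).indicator (fun _ => g₂) t) := le_lintegral_add _ _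
    _ ≤ _ := lintegral_mono fun t => by
        rcases lt_trichotomy t (z s) with hlt | heq | hgt
        · rw [h.run_cons_of_lt hM hz hlt]
          simp [hlt, hlt.le, g₁]
        · simp [heq]
        · rw [h.run_cons_of_gt hM hs hz hgt]
          simp [hgt, hgt.le, g₂]

theorem SurvivalFrom.cons {n : ℝ} (hn : 0 < n) (hL : I.IsStarList A b (r :: L))
    (h : I.SurvivalFrom n A b L) : I.SurvivalFrom n A b (r :: L) := by
  intro M hM s hs y
  have hMr := hM r List.mem_cons_self
  have hbA := hL.notMem r List.mem_cons_self
  have hsA : s ∈ A := (Finset.mem_filter.1 hs).1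
  have hMb : ∀ q ∈ L, b q ∉ (insert (b r, r) M).image Prod.fst := by
    intro q hq
    rw [Finset.image_insert, Finset.mem_insert, not_or]
    refine ⟨fun e => ?_, hM q (List.mem_cons_of_mem _ hq)⟩
    exact (List.nodup_cons.1 hL.nodup).1 (List.mem_map.2 ⟨q, hq, e⟩)
  have hMs : ∀ q ∈ L, b q ∉ (insert (s, r) M).image Prod.fst := by
    intro q hq
    rw [Finset.image_insert, Finset.mem_insert, not_or]
    exact ⟨fun e => hL.tail.notMem q hq (e ▸ hsA), hM q (List.mem_cons_of_mem _ hq)⟩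
  have hfreeb : free A (insert (b r, r) M) = free A M := by
    rw [free_insert]
    exact Finset.erase_eq_of_notMem fun hmem => hbA (Finset.mem_filter.1 hmem).1
  have hfrees : free A (insert (s, r) M) = (free A M).erase s := free_insert _ _ _ _
  set S := free A M with hS
  set B := (L.map b).toFinset with hB
  obtain ⟨D, hD⟩ : ∃ D, S.card = D + 1 :=
    ⟨S.card - 1, by have := Finset.card_pos.2 ⟨s, hs⟩; omega⟩
  have hDs : (S.erase s).card = D := by rw [Finset.card_erase_of_mem hs, hD]; rfl
  have hbT : b r ∉ S.erase s ∪ B := by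
    rw [Finset.mem_union, not_or]
    refine ⟨fun hmem => hbA (Finset.mem_filter.1 (Finset.mem_of_mem_erase hmem)).1, fun hmem => ?_⟩
    exact (List.nodup_cons.1 hL.nodup).1 (List.mem_toFinset.1 hmem)
  have hT : S.erase s ∪ ((r :: L).map b).toFinset = insert (b r) (S.erase s ∪ B) := by
    rw [List.map_cons, List.toFinset_cons, Finset.union_insert]
  have hsT : s ∉ S.erase s ∪ B := by
    rw [Finset.mem_union, not_or]
    refine ⟨Finset.notMem_erase _ _, fun hmem => ?_⟩
    obtain ⟨q, hq, rfl⟩ := List.mem_map.1 (List.mem_toFinset.1 hmem)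
    exact hL.tail.notMem q hq hsA
  -- If `b r` is taken, `s` remains the lowest free server. If `s` is taken, all that is known of
  -- the remaining free ranks is that they exceed `y s`, hence the averaged form with `c = y s`.
  have h₁ := h (insert (b r, r) M) hMb s (hfreeb.symm ▸ hs) y
  have h₂ := h.above hL.tail (insert (s, r) M) hMs (y s) y
  rw [hfreeb, hD, Nat.add_sub_cancel] at h₁
  rw [hfrees, hDs] at h₂
  have hy0 : (0 : ℝ) ≤ y s := (y s).2.1
  have hy1 : (0 : ℝ) ≤ 1 - y s := sub_nonneg.2 (y s).2.2
  have hmeas : Measurable fun z : Fin I.numServers → unitInterval =>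
      aboveRank (S.erase s) (z s) z * ((free A (I.run z M (r :: L))).card : ℝ≥0∞) :=
    (measurable_aboveRank _ (measurable_pi_apply s)).mul
      (measurable_of_run (r :: L) M fun N => ((free A N).card : ℝ≥0∞))
  rw [hT, lmarginal_insert' _ hmeas hbT, List.length_cons, hD, Nat.add_sub_cancel]
  have hreal : survivalBound n (L.length + 1) (D + 1 : ℕ) (1 - y s) * (1 - y s) ^ D ≤
      y s * (survivalBound n L.length (D + 1 : ℕ) (1 - y s) * (1 - y s) ^ D) +
        (1 - y s) * (survivalBound n L.length D ((1 - y s) * D / (D + 1)) * (1 - y s) ^ D) := by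
    have := survivalBound_succ_le hn L.length (D := (D + 1 : ℕ)) (by positivity) (1 - y s)
    have := mul_le_mul_of_nonneg_right this (pow_nonneg hy1 D)
    push_cast at this ⊢
    rw [add_sub_cancel_right, sub_sub_cancel] at this
    linarith
  calc _ ≤ ENNReal.ofReal _ := ENNReal.ofReal_le_ofReal hreal
    _ ≤ _ := ENNReal.ofReal_add_le
    _ = ENNReal.ofReal (y s) * ENNReal.ofReal
            (survivalBound n L.length (D + 1 : ℕ) (1 - y s) * (1 - y s) ^ D) +
          ENNReal.ofReal (1 - y s) * ENNReal.ofReal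
            (survivalBound n L.length D ((1 - y s) * D / (D + 1)) * (1 - y s) ^ D) := by
        rw [ENNReal.ofReal_mul hy0, ENNReal.ofReal_mul hy1]
    _ ≤ _ := add_le_add (mul_le_mul_right h₁ _) (mul_le_mul_right h₂ _)
    _ ≤ _ := add_le_add (mul_lmarginal_le _ _) (mul_lmarginal_le _ _)
    _ ≤ _ := lmarginal_add_lmarginal_le _ _
    _ ≤ _ := lmarginal_le_lmarginal fun z hz => by
        rw [← hz s hsT]
        exact hL.head_step hMr hs z

theorem IsStarList.survivalFrom {n : ℝ} (hn : 0 < n) (hL : I.IsStarList A b L) :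
    I.SurvivalFrom n A b L := by
  induction L with
  | cons r L ih => exact (ih hL.tail).cons hn hL
  | nil =>
    intro M _ s hs y
    have hpos : 0 < (free A M).card := Finset.card_pos.2 ⟨s, hs⟩
    have hy1 : (0 : ℝ) ≤ 1 - y s := sub_nonneg.2 (y s).2.2
    simp only [List.length_nil, List.map_nil, List.toFinset_nil, Finset.union_empty, survivalBound,
      pow_zero, CharP.cast_eq_zero, zero_div, zero_mul, add_zero, one_mul]
    calc ENNReal.ofReal ((free A M).card * (1 - y s) ^ ((free A M).card - 1))
        = ((free A M).card : ℝ≥0∞) *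
            lmarginal (fun _ => volume) ((free A M).erase s)
              (aboveRank ((free A M).erase s) (y s)) y := by
          rw [lmarginal_aboveRank, Finset.card_erase_of_mem hs, ENNReal.ofReal_mul (by positivity),
            ENNReal.ofReal_natCast, ENNReal.ofReal_pow hy1]
      _ ≤ _ := mul_lmarginal_le _ _
      _ ≤ _ := lmarginal_le_lmarginal fun z hz => by
          rw [hz s (Finset.notMem_erase _ _), mul_comm]
          rfl

theorem IsStarList.le_lintegral_card_free {n : ℝ} (hn : 0 < n) (hL : I.IsStarList A b L)
    (hcard : (A.card : ℝ) = n) (huniv : A ∪ (L.map b).toFinset = Finset.univ) :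
    ENNReal.ofReal ((n / (n + 1)) ^ L.length * n) ≤
      ∫⁻ y : Fin I.numServers → unitInterval, ((free A (I.run y ∅ L)).card : ℝ≥0∞) := by
  have hA : free A (∅ : Finset (Fin I.numServers × Fin I.numRequests)) = A := by simp [free]
  have h := (hL.survivalFrom hn).above hL ∅ (by simp) 0 (fun _ => 0)
  rw [hA, huniv, hcard, lmarginal_univ] at h
  refine (le_of_eq ?_).trans (h.trans ?_)
  · congr 1
    -- At `c = 0` and `D = n`, the correction `D - (n + 1) * x` is zero.
    have : n + 1 ≠ 0 := by positivity
    simp only [survivalBound, Set.Icc.coe_zero, sub_zero, one_mul, one_pow, mul_one,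
      mul_div_cancel₀ n this, sub_self, mul_zero, add_zero]
  · exact lintegral_mono fun y => mul_le_of_le_one_left (zero_le) (aboveRank_le_one _ _ _)

end Instance

/-! ### The hard instance: degrees, optimum and expected loss -/

/-- The hard instance: `n` common servers and `k` private ones. The `i`-th of the first `k` requests
is adjacent to all common servers and to the `i`-th private server; the remaining requests are
adjacent to a single private server each. -/
abbrev starInstance (n k : ℕ) : Instance where
  numServers := n + k
  numRequests := k + k * k
  nbr := Fin.addCases (fun i => insert (Fin.natAdd n i) (Finset.univ.image (Fin.castAdd k)))
    fun q => {Fin.natAdd n (finProdFinEquiv.symm q).1}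

namespace starInstance

variable (n k : ℕ)

/-- The common servers. -/
def common : Finset (Fin (starInstance n k).numServers) :=
  Finset.univ.image (Fin.castAdd k : Fin n → Fin (n + k))

/-- The private server adjacent to a request. -/
def privateServer : Fin (starInstance n k).numRequests → Fin (starInstance n k).numServers :=
  Fin.addCases (m := k) (n := k * k) (motive := fun _ => Fin (n + k)) (fun i => Fin.natAdd n i)
    fun q => Fin.natAdd n (finProdFinEquiv.symm q).1

/-- The requests adjacent to the common servers, in order of arrival. -/
def starRequests : List (Fin (starInstance n k).numRequests) :=
  List.ofFn (Fin.castAdd (k * k) : Fin k → Fin (k + k * k))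

/-- The requests adjacent to a private server only, in order of arrival. -/
def privateRequests : List (Fin (starInstance n k).numRequests) :=
  List.ofFn (Fin.natAdd k : Fin (k * k) → Fin (k + k * k))

theorem finRange_eq : List.finRange (starInstance n k).numRequests =
    starRequests n k ++ privateRequests n k := by
  rw [← List.ofFn_id]
  exact List.ofFn_add

theorem natAdd_notMem_common (i : Fin k) : (Fin.natAdd n i : Fin (n + k)) ∉ common n k := by
  intro h
  obtain ⟨j, -, hj⟩ := Finset.mem_image.1 h
  have := congrArg Fin.val hj
  simp at this
  omega

theorem nbr_castAdd (i : Fin k) : (starInstance n k).nbr (Fin.castAdd (k * k) i) =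
    insert (Fin.natAdd n i : Fin (n + k)) (common n k) := by
  simp only [Fin.addCases_left, common]

theorem nbr_natAdd (q : Fin (k * k)) : (starInstance n k).nbr (Fin.natAdd k q) =
    {(Fin.natAdd n (finProdFinEquiv.symm q).1 : Fin (n + k))} := by
  simp only [Fin.addCases_right]

theorem privateServer_castAdd (i : Fin k) :
    privateServer n k (Fin.castAdd (k * k) i) = (Fin.natAdd n i : Fin (n + k)) :=
  Fin.addCases_left i

theorem map_starRequests : (starRequests n k).map (privateServer n k) =
    List.ofFn (Fin.natAdd n : Fin k → Fin (n + k)) := by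
  rw [starRequests, List.map_ofFn]
  congr 1
  funext i
  exact privateServer_castAdd n k i

theorem isStarList : (starInstance n k).IsStarList (common n k) (privateServer n k)
    (starRequests n k) where
  nbr_eq := by
    intro r hr
    obtain ⟨i, rfl⟩ := List.mem_ofFn.1 hr
    rw [privateServer_castAdd]
    exact nbr_castAdd n k i
  notMem := by
    intro r hr
    obtain ⟨i, rfl⟩ := List.mem_ofFn.1 hr
    rw [privateServer_castAdd]
    exact natAdd_notMem_common n k i
  nodup := by
    rw [map_starRequests]
    exact List.nodup_ofFn.2 (Fin.natAdd_injective k n)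

theorem card_common : (common n k).card = n := by
  rw [common, Finset.card_image_of_injective _ (Fin.castAdd_injective n k)]
  simp

theorem common_union : common n k ∪ ((starRequests n k).map (privateServer n k)).toFinset =
    Finset.univ := by
  rw [map_starRequests, Finset.eq_univ_iff_forall]
  intro s
  rw [Finset.mem_union, List.mem_toFinset, List.mem_ofFn]
  refine Fin.addCases (fun i => Or.inl ?_) (fun i => Or.inr ⟨i, rfl⟩) s
  exact Finset.mem_image_of_mem _ (Finset.mem_univ i)

theorem isBounded : (starInstance n k).IsBounded k (n + 1) := by
  constructor
  · refine Fin.addCases (m := n) (n := k) (fun i => ?_) (fun i => ?_)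
    · have hsub : Finset.univ.image (Fin.castAdd (k * k) : Fin k → Fin (k + k * k)) ⊆
          (starInstance n k).serverNbr (Fin.castAdd k i : Fin (n + k)) := by
        intro r hr
        obtain ⟨j, -, rfl⟩ := Finset.mem_image.1 hr
        refine Finset.mem_filter.2 ⟨Finset.mem_univ _, ?_⟩
        rw [nbr_castAdd]
        exact Finset.mem_insert_of_mem (Finset.mem_image_of_mem _ (Finset.mem_univ i))
      have := Finset.card_le_card hsub
      rwa [Finset.card_image_of_injective _ (Fin.castAdd_injective _ _), Finset.card_univ,
        Fintype.card_fin] at this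
    · have hsub : Finset.univ.image
          (fun j : Fin k => (Fin.natAdd k (finProdFinEquiv (i, j)) : Fin (k + k * k))) ⊆
          (starInstance n k).serverNbr (Fin.natAdd n i : Fin (n + k)) := by
        intro r hr
        obtain ⟨j, -, rfl⟩ := Finset.mem_image.1 hr
        refine Finset.mem_filter.2 ⟨Finset.mem_univ _, ?_⟩
        rw [nbr_natAdd, Equiv.symm_apply_apply]
        exact Finset.mem_singleton_self _
      have := Finset.card_le_card hsub
      rwa [Finset.card_image_of_injective, Finset.card_univ, Fintype.card_fin] at this
      intro j j' h
      have := finProdFinEquiv.injective (Fin.natAdd_injective _ _ h)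
      exact congrArg Prod.snd this
  · refine Fin.addCases (m := k) (n := k * k) (fun i => ?_) (fun q => ?_)
    · rw [nbr_castAdd]
      exact (Finset.card_insert_le _ _).trans (by rw [card_common])
    · rw [nbr_natAdd, Finset.card_singleton]
      omega

/-- A matching of all servers, as a map from servers to requests. -/
def partner {n k : ℕ} (h : n ≤ k) : Fin (n + k) → Fin (k + k * k) :=
  Fin.addCases (fun i => Fin.castAdd (k * k) (Fin.castLE h i))
    -- Any request in the `i`-th block would do; the second coordinate `i` is merely available.
    fun i => Fin.natAdd k (finProdFinEquiv (i, i))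

theorem partner_injective {n k : ℕ} (h : n ≤ k) : Function.Injective (partner h) := by
  have hne : ∀ (i : Fin n) (j : Fin k), partner h (Fin.castAdd k i) ≠ partner h (Fin.natAdd n j) := by
    intro i j hij
    have := congrArg Fin.val hij
    simp only [partner, Fin.addCases_left, Fin.addCases_right, Fin.val_castAdd, Fin.val_castLE,
      Fin.val_natAdd] at this
    omega
  intro s t
  refine Fin.addCases (fun i => ?_) (fun i => ?_) s <;>
    refine Fin.addCases (fun j => ?_) (fun j => ?_) t <;> intro hst
  · simp only [partner, Fin.addCases_left] at hst
    rw [Fin.castLE_injective h (Fin.castAdd_injective _ _ hst)]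
  · exact absurd hst (hne i j)
  · exact absurd hst.symm (hne j i)
  · simp only [partner, Fin.addCases_right] at hst
    have := finProdFinEquiv.injective (Fin.natAdd_injective _ _ hst)
    rw [show i = j from congrArg Prod.fst this]

theorem mem_nbr_partner {n k : ℕ} (h : n ≤ k) (s : Fin (n + k)) :
    s ∈ (starInstance n k).nbr (partner h s) := by
  refine Fin.addCases (fun i => ?_) (fun i => ?_) s
  · simp only [partner, Fin.addCases_left]
    exact Finset.mem_insert_of_mem (Finset.mem_image_of_mem _ (Finset.mem_univ i))
  · simp only [partner, Fin.addCases_right, Equiv.symm_apply_apply]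
    exact Finset.mem_singleton_self _

theorem le_opt {n k : ℕ} (h : n ≤ k) : n + k ≤ (starInstance n k).opt := by
  classical
  let M : Finset (Fin (starInstance n k).numServers × Fin (starInstance n k).numRequests) :=
    Finset.univ.image fun s : Fin (n + k) => (s, partner h s)
  have hcard : M.card = n + k := by
    rw [Finset.card_image_of_injective _ fun s t hst => congrArg Prod.fst hst]
    simp
  have hM : (starInstance n k).IsMatching M := by
    constructor
    · intro e he
      obtain ⟨s, -, rfl⟩ := Finset.mem_image.1 he
      exact mem_nbr_partner h s
    · intro e he f hf hef
      obtain ⟨s, -, rfl⟩ := Finset.mem_image.1 he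
      obtain ⟨t, -, rfl⟩ := Finset.mem_image.1 hf
      have : s = t := hef.elim id fun hst => partner_injective h hst
      rw [this]
  have : M.card ≤ (starInstance n k).opt :=
    Finset.le_sup (f := Finset.card) (Finset.mem_filter.2 ⟨Finset.mem_univ _, hM⟩)
  rwa [hcard] at this

/-- Pointwise, matched servers and free common servers together number at most `n + k`, and the
private requests leave the free common servers as they are. -/
theorem expRanking_add_le {n : ℕ} (k : ℕ) (hn : 0 < n) :
    (starInstance n k).expRanking + ENNReal.ofReal (((n : ℝ) / (n + 1)) ^ k * n) ≤
      ((n + k : ℕ) : ℝ≥0∞) := by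
  have hlen : (starRequests n k).length = k := List.length_ofFn
  have h := (isStarList n k).le_lintegral_card_free (n := n) (by positivity)
    (by rw [card_common]) (common_union n k)
  rw [hlen] at h
  refine (add_le_add le_rfl h).trans ((le_lintegral_add _ _).trans ?_)
  calc _ ≤ ∫⁻ _ : Fin (starInstance n k).numServers → unitInterval, ((n + k : ℕ) : ℝ≥0∞) := by
        refine lintegral_mono fun y => ?_
        have hpriv : ∀ r ∈ privateRequests n k,
            Disjoint ((starInstance n k).nbr r) (common n k) := by
          intro r hr
          obtain ⟨q, rfl⟩ := List.mem_ofFn.1 hr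
          rw [nbr_natAdd, Finset.disjoint_singleton_left]
          exact natAdd_notMem_common n k _
        have hrank : (starInstance n k).ranking y = (starInstance n k).run y
            ((starInstance n k).run y ∅ (starRequests n k)) (privateRequests n k) := by
          rw [Instance.ranking, finRange_eq, List.foldl_append]
          rfl
        have hfree := Instance.free_run_of_disjoint (common n k) y _ hpriv
          ((starInstance n k).run y ∅ (starRequests n k))
        have hle := Instance.card_run_add_card_free_le (common n k) y
          (List.finRange (starInstance n k).numRequests)
        change ((starInstance n k).ranking y).card +
          (Instance.free (common n k) ((starInstance n k).ranking y)).card ≤ n + k at hle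
        rw [hrank, hfree] at hle
        rw [hrank]
        rw [← Nat.cast_add]
        exact Nat.cast_le.2 hle
    _ = _ := by
      rw [lintegral_const, volume_pi, measure_univ, mul_one]

end starInstance

/-! ### The competitive ratio and its limit -/

theorem rankingRatio_le {k d : ℕ} (hd : 2 ≤ d) (hdk : d < k) :
    rankingRatio k d ≤
      ENNReal.ofReal (1 - (1 - 1 / (d : ℝ)) ^ k * ((d : ℝ) - 1) / ((k : ℝ) + (d : ℝ) - 1)) := by
  obtain ⟨n, rfl⟩ : ∃ n, d = n + 1 := ⟨d - 1, by omega⟩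
  have hn : 0 < n := by omega
  have hopt := starInstance.le_opt (n := n) (k := k) (by omega)
  have hexp := starInstance.expRanking_add_le k hn
  have hN : (0 : ℝ) < (n + k : ℕ) := by exact_mod_cast (by omega : 0 < n + k)
  refine (iInf_le_of_le (starInstance n k) (iInf_le_of_le (starInstance.isBounded n k)
    (iInf_le_of_le (by omega) le_rfl))).trans ?_
  calc (starInstance n k).expRanking / ((starInstance n k).opt : ℝ≥0∞)
      ≤ ENNReal.ofReal ((n + k : ℕ) - ((n : ℝ) / (n + 1)) ^ k * n) /
          ENNReal.ofReal ((n + k : ℕ) : ℝ) := by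
        refine ENNReal.div_le_div ?_ ?_
        · rw [ENNReal.ofReal_sub _ (by positivity), ENNReal.ofReal_natCast]
          exact ENNReal.le_sub_of_add_le_right ENNReal.ofReal_ne_top hexp
        · rw [ENNReal.ofReal_natCast]
          exact_mod_cast hopt
    _ = _ := by
        rw [← ENNReal.ofReal_div_of_pos hN]
        congr 1
        have h1 : (1 : ℝ) - 1 / ((n + 1 : ℕ) : ℝ) = n / (n + 1) := by
          push_cast
          field_simp
          ring
        have h2 : (k : ℝ) + ((n + 1 : ℕ) : ℝ) - 1 = (n + k : ℕ) := by
          push_cast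
          ring
        have h3 : ((n + 1 : ℕ) : ℝ) - 1 = n := by
          push_cast
          ring
        rw [h1, h2, h3, sub_div, div_self hN.ne']

theorem tendsto_ratioBound {α : ℝ} (hα : 1 < α) {k d : ℕ → ℕ}
    (hd : Filter.Tendsto d Filter.atTop Filter.atTop) (hk : ∀ n, (k n : ℝ) = α * d n) :
    Filter.Tendsto (fun n => 1 - (1 - 1 / (d n : ℝ)) ^ k n * ((d n : ℝ) - 1) /
      ((k n : ℝ) + (d n : ℝ) - 1)) Filter.atTop (nhds (1 - Real.exp (-α) / (α + 1))) := by
  have hinv : Filter.Tendsto (fun n => 1 / (d n : ℝ)) Filter.atTop (nhds 0) :=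
    tendsto_one_div_atTop_nhds_zero_nat.comp hd
  have hpow : Filter.Tendsto (fun n => (1 - 1 / (d n : ℝ)) ^ k n) Filter.atTop
      (nhds (Real.exp (-α))) := by
    -- Since `k = α * d`, the power is `((1 - 1 / d) ^ d) ^ α` with a real exponent, once `d ≥ 1`
    -- makes the base nonnegative.
    have h1 : Filter.Tendsto (fun n => ((1 + -1 / (d n : ℝ)) ^ d n) ^ α) Filter.atTop
        (nhds (Real.exp (-1) ^ α)) :=
      ((Real.tendsto_one_add_div_pow_exp (-1)).comp hd).rpow_const
        (Or.inl (Real.exp_pos _).ne')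
    rw [← Real.exp_mul, neg_one_mul] at h1
    refine h1.congr' ?_
    filter_upwards [hd.eventually_ge_atTop 1] with n hn
    have hn' : (1 : ℝ) ≤ d n := by exact_mod_cast hn
    have h0 : (0 : ℝ) ≤ 1 - 1 / (d n : ℝ) := by
      rw [sub_nonneg, div_le_one (by linarith)]
      exact hn'
    rw [show 1 + -1 / (d n : ℝ) = 1 - 1 / (d n : ℝ) by ring, ← Real.rpow_natCast _ (d n),
      ← Real.rpow_mul h0, mul_comm, ← hk, Real.rpow_natCast]
  have hfrac : Filter.Tendsto (fun n => (1 - 1 / (d n : ℝ)) / (α + 1 - 1 / (d n : ℝ)))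
      Filter.atTop (nhds ((1 - 0) / (α + 1 - 0))) :=
    (hinv.const_sub 1).div (hinv.const_sub (α + 1)) (by linarith)
  have hlim := (hpow.mul hfrac).const_sub 1
  rw [sub_zero, sub_zero, mul_one_div] at hlim
  refine hlim.congr' ?_
  filter_upwards [hd.eventually_ge_atTop 1] with n hn
  have hn' : (1 : ℝ) ≤ d n := by exact_mod_cast hn
  have hpos : (d n : ℝ) ≠ 0 := by linarith
  have hfr : (1 - 1 / (d n : ℝ)) / (α + 1 - 1 / (d n : ℝ)) =
      ((d n : ℝ) - 1) / ((k n : ℝ) + (d n : ℝ) - 1) := by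
    rw [hk, ← mul_div_mul_left _ _ hpos]
    congr 1 <;> field_simp
  rw [hfr, mul_div_assoc]

end OnlineMatching

theorem mainTheorem8 :
    (∀ k d : ℕ, 2 ≤ d → d < k →
      OnlineMatching.rankingRatio k d ≤
        ENNReal.ofReal
          (1 - (1 - 1 / (d : ℝ)) ^ k * ((d : ℝ) - 1) / ((k : ℝ) + (d : ℝ) - 1))) ∧
    (∀ α : ℝ, 1 < α → ∀ k d : ℕ → ℕ,
      Filter.Tendsto d Filter.atTop Filter.atTop →
      (∀ n, (k n : ℝ) = α * (d n : ℝ)) →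
      Filter.limsup (fun n => OnlineMatching.rankingRatio (k n) (d n)) Filter.atTop ≤
        ENNReal.ofReal (1 - Real.exp (-α) / (α + 1))) := by
  refine ⟨fun k d hd hdk => OnlineMatching.rankingRatio_le hd hdk, fun α hα k d hd hk => ?_⟩
  have hlim := ENNReal.tendsto_ofReal (OnlineMatching.tendsto_ratioBound hα hd hk)
  -- The limit is viewed as the limsup of the finite bounds, so an eventual comparison suffices; `d
  -- ≥ 2` and `α > 1` give `d < k`.
  rw [← hlim.limsup_eq]
  refine Filter.limsup_le_limsup ?_
  filter_upwards [hd.eventually_ge_atTop 2] with n hn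
  refine OnlineMatching.rankingRatio_le hn ?_
  have hn' : (2 : ℝ) ≤ d n := by exact_mod_cast hn
  have : (d n : ℝ) < k n := by
    rw [hk]
    nlinarith
  exact_mod_cast this
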